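/- **Notation.** For a self-map $g:A\to A$ let ${\rm ent}_{\rm set}(g)=\sup_D\lim_{n\to\infty}\frac1n|D\cup g(D)\cup\cdots\cup g^{n-1}(D)|$, the supremum over finite $D\subseteq A$. If $k:A\to A$ is a self-map and ${\rm sc}(k)=\bigcap_{n\ge1}k^n(A)$, let ${\rm ent}_{\rm cset}(k)=\sup_D\lim_{n\to\infty}\frac1n|D\cup g^{-1}(D)\cup\cdots\cup g^{-(n-1)}(D)|$, where $g=k\restriction_{{\rm sc}(k)}:{\rm sc}(k)\to{\rm sc}(k)$ and $D$ runs over the finite subsets of ${\rm sc}(k)$ (this is used when $g$ is onto and finite fibre, i.e. all its point-preimages are finite; in particular when $k$ is finite fibre). For a continuous self-map $T$ of a compact space, ${\rm ent}_{\rm top}(T)=\sup_{\mathcal U}\lim_{n\to\infty}\frac1n\log N(\mathcal U\vee T^{-1}\mathcal U\vee\cdots\vee T^{-(n-1)}\mathcal U)$ over finite open covers $\mathcal U$, where $N$ is the least cardinality of a subcover. For a group endomorphism $\theta:K\to K$, ${\rm ent}_{\rm alg}(\theta)=\sup_H\lim_{n\to\infty}\frac1n\log|H\cdot\theta(H)\cdots\theta^{n-1}(H)|$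 over finite subgroups $H$ of $K$. For $\varphi:\Gamma\to\Gamma$ the generalized shift $\sigma_\varphi:Y^\Gamma\to Y^\Gamma$ is $\sigma_\varphi((x_\alpha)_{\alpha})=(x_{\varphi(\alpha)})_{\alpha}$; for a group $Y$, $\bigoplus_\Gamma Y\le Y^\Gamma$ is the subgroup of families equal to the identity at all but finitely many indices, which $\sigma_\varphi$ preserves when $\varphi$ is finite fibre. Let $\mathcal C$ be the class of all generalized shifts $\sigma_\psi:Y^\Gamma\to Y^\Gamma$ such that $Y$ is a nontrivial finite discrete group, $\Gamma$ is a nonempty set, $Y^\Gamma$ has the product topology, and both $\psi$ and $\sigma_\psi$ are finite fibre. **Statement.** (1) In the following table (row $p$, column $q$), the mark $\surd$ means that $p\le q$ for all $\sigma_\psi:Y^\Gamma\to Y^\Gamma$ in $\mathcal C$, and the mark $\times$ means that $p>q$ for some $\sigma_\psi$ in $\mathcal C$: $$\begin{array}{l|c|c|c|c} p\ \backslash\ q & {\rm ent}_{\rm top}(\sigma_\psi) & {\rm ent}_{\rm alg}(\sigma_\psi\restriction_{\bigoplus_\Gamma Y}) & {\rm ent}_{\rm cset}(\sigma_\psi)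 & {\rm ent}_{\rm set}(\sigma_\psi)\\ \hline {\rm ent}_{\rm top}(\sigma_\psi) & \surd & \times & \surd & \surd\\ {\rm ent}_{\rm alg}(\sigma_\psi\restriction_{\bigoplus_\Gamma Y}) & \times & \surd & \times & \surd\\ {\rm ent}_{\rm cset}(\sigma_\psi) & \times & \times & \surd & \surd\\ {\rm ent}_{\rm set}(\sigma_\psi) & \times & \times & \times & \surd \end{array}$$ (2) Define $\lambda_1,\lambda_2,\lambda_3:\mathbb Z\to\mathbb Z$ by: $\lambda_1(0)=\lambda_2(0)=0$; $\lambda_1(n)=n-1$ and $\lambda_2(n)=n+1$ for $n\ge1$; $\lambda_1(n)=n+1$ and $\lambda_2(n)=n-1$ for $n\le-1$; $\lambda_3(1)\in\{0,1\}$ (either choice), and, for $n\ne1$, $\lambda_3(n)=n$ if $n=k(k+1)/2$ for some integer $k$ and $\lambda_3(n)=n+1$ otherwise. Then $\lambda_1,\lambda_2,\lambda_3$ are finite fibre, and for every nontrivial finite discrete abelian group $G$ the shifts $\sigma_{\lambda_1},\sigma_{\lambda_2}:G^{\mathbb Z}\to G^{\mathbb Z}$ belong to $\mathcal C$, and $$\begin{array}{l|c|c|c|c}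 & {\rm ent}_{\rm top}(\sigma_{\lambda_i}) & {\rm ent}_{\rm alg}(\sigma_{\lambda_i}\restriction_{\bigoplus_{\mathbb Z}G}) & {\rm ent}_{\rm cset}(\sigma_{\lambda_i}) & {\rm ent}_{\rm set}(\sigma_{\lambda_i})\\ \hline \lambda_1 & 0 & 2\log|G| & 0 & \infty\\ \lambda_2 & 2\log|G| & 0 & \infty & \infty\\ \lambda_3 & 0 & \log|G| & 0 & \infty \end{array}$$ (In particular $\lambda_1$ and $\lambda_2$ witness all the marks $\times$.) -/

import Mathlib

open Set Filter
open scoped ENNReal Pointwise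

universe u v w

noncomputable section

namespace GenShift

/-- A map is finite fibre if every point has finitely many preimages. -/
def FiniteFibre {A : Type*} {B : Type*} (g : A → B) : Prop :=
  ∀ b : B, (g ⁻¹' {b}).Finite

/-! ### Set-theoretical entropy -/

/-- `ent_set(g, D) = lim |D ∪ g(D) ∪ ⋯ ∪ g^{n-1}(D)| / n`. The limit exists for finite `D`;
it is written as an upper limit so that the expression is total. -/
def setEntropyAt {A : Type*} (g : A → A) (D : Set A) : ℝ≥0∞ :=
  limsup (fun n : ℕ => ((⋃ i < n, g^[i] '' D).encard : ℝ≥0∞) / (n : ℝ≥0∞)) atTop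

/-- The set-theoretical entropy of a self-map. -/
def setEntropy {A : Type*} (g : A → A) : ℝ≥0∞ :=
  ⨆ (D : Set A) (_ : D.Finite), setEntropyAt g D

/-! ### Contravariant set-theoretical entropy -/

/-- `lim |D ∪ g⁻¹(D) ∪ ⋯ ∪ g^{-(n-1)}(D)| / n`. The limit exists for `g` onto and finite fibre
and `D` finite; it is written as an upper limit so that the expression is total. -/
def csetEntropyAt {A : Type*} (g : A → A) (D : Set A) : ℝ≥0∞ :=
  limsup (fun n : ℕ => ((⋃ i < n, g^[i] ⁻¹' D).encard : ℝ≥0∞) / (n : ℝ≥0∞)) atTop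

/-- Contravariant entropy of an onto finite fibre self-map. -/
def csetEntropyOnto {A : Type*} (g : A → A) : ℝ≥0∞ :=
  ⨆ (D : Set A) (_ : D.Finite), csetEntropyAt g D

/-- The surjective cover `sc(k) = ⋂_{n ≥ 1} k^n(A)`. -/
def surjCover {A : Type*} (k : A → A) : Set A :=
  ⋂ n ≥ 1, range (k^[n])

theorem mapsTo_surjCover {A : Type*} (k : A → A) :
    MapsTo k (surjCover k) (surjCover k) := by
  intro x hx
  simp only [surjCover, mem_iInter] at hx ⊢
  intro n hn
  obtain ⟨y, rfl⟩ := hx n hn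
  exact ⟨k y, by rw [← Function.iterate_succ_apply, Function.iterate_succ_apply']⟩

/-- The contravariant set-theoretical entropy of a self-map `k`: that of the restriction of `k`
to its surjective cover. -/
def csetEntropy {A : Type*} (k : A → A) : ℝ≥0∞ :=
  csetEntropyOnto (mapsTo_surjCover k).restrict

/-! ### Topological entropy -/

/-- `N(U)`: the least cardinality of a finite subcover of `U`. -/
def coverNumber {Z : Type*} (U : Set (Set Z)) : ℕ :=
  sInf {m : ℕ | ∃ W : Set (Set Z), W ⊆ U ∧ W.Finite ∧ ⋃₀ W = univ ∧ W.ncard = m}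

/-- The common refinement `U ∨ T⁻¹(U) ∨ ⋯ ∨ T^{-(n-1)}(U)`. -/
def iteratedJoin {Z : Type*} (T : Z → Z) (U : Set (Set Z)) (n : ℕ) : Set (Set Z) :=
  {V | ∃ f : ℕ → Set Z, (∀ i, f i ∈ U) ∧ V = ⋂ i < n, T^[i] ⁻¹' f i}

/-- `ent_top(T, U) = lim log N(U ∨ ⋯ ∨ T^{-(n-1)}(U)) / n` (the limit exists for an open cover
of a compact space and continuous `T`). -/
def topEntropyAt {Z : Type*} (T : Z → Z) (U : Set (Set Z)) : ℝ≥0∞ :=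
  limsup (fun n : ℕ =>
    ENNReal.ofReal (Real.log (coverNumber (iteratedJoin T U n)) / n)) atTop

/-- The topological entropy, by finite open covers. -/
def topEntropy {Z : Type*} [TopologicalSpace Z] (T : Z → Z) : ℝ≥0∞ :=
  ⨆ (U : Set (Set Z)) (_ : U.Finite ∧ (∀ V ∈ U, IsOpen V) ∧ ⋃₀ U = univ), topEntropyAt T U

/-! ### Algebraic entropy -/

/-- The trajectory `H · θ(H) · ⋯ · θ^{n-1}(H)`. -/
def trajectory {K : Type*} [Group K] (θ : K →* K) (H : Set K) : ℕ → Set K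
  | 0 => {1}
  | n + 1 => trajectory θ H n * (θ^[n] '' H)

/-- `ent_alg(θ, H) = lim log |H · θ(H) · ⋯ · θ^{n-1}(H)| / n`
(the limit exists for finite nonempty `H`). -/
def algEntropyAt {K : Type*} [Group K] (θ : K →* K) (H : Set K) : ℝ≥0∞ :=
  limsup (fun n : ℕ => ENNReal.ofReal (Real.log ((trajectory θ H n).ncard) / n)) atTop

/-- The algebraic entropy of an endomorphism: supremum over finite subgroups. -/
def algEntropy {K : Type*} [Group K] (θ : K →* K) : ℝ≥0∞ :=
  ⨆ (H : Subgroup K) (_ : (H : Set K).Finite), algEntropyAt θ (H : Set K)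

/-! ### Generalized shifts -/

/-- The generalized shift `σ_φ((x_α)_α) = (x_{φ(α)})_α` on `X^Γ`. -/
def shift (X : Type*) {Γ : Type*} (φ : Γ → Γ) : (Γ → X) → (Γ → X) :=
  fun x α => x (φ α)

/-- The direct sum `⊕_Γ Y` as the subgroup of `Y^Γ` of the families that equal the identity at
all but finitely many indices. -/
def finSum (Γ : Type*) (Y : Type*) [Group Y] : Subgroup (Γ → Y) where
  carrier := {x | {α | x α ≠ 1}.Finite}
  mul_mem' := by
    intro x y hx hy
    refine (hx.union hy).subset ?_
    intro α hα
    by_contra h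
    simp only [mem_union, mem_ofPred_eq, not_or, not_not] at h
    exact hα (by simp [h.1, h.2])
  one_mem' := by simp
  inv_mem' := by
    intro x hx
    simpa using hx

theorem shift_mem_finSum {Γ : Type*} (Y : Type*) [Group Y] {φ : Γ → Γ} (hφ : FiniteFibre φ)
    {x : Γ → Y} (hx : x ∈ finSum Γ Y) : shift Y φ x ∈ finSum Γ Y :=
  Set.Finite.preimage' (f := φ) (s := {α | x α ≠ 1}) hx (fun b _ => hφ b)

/-- The restriction of `σ_φ` to `⊕_Γ Y`, for a finite fibre `φ`, as an endomorphism. -/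
def shiftSum {Γ : Type*} (Y : Type*) [Group Y] (φ : Γ → Γ) (hφ : FiniteFibre φ) :
    finSum Γ Y →* finSum Γ Y where
  toFun x := ⟨shift Y φ x, shift_mem_finSum Y hφ x.2⟩
  map_one' := rfl
  map_mul' _ _ := rfl

/-- The class `𝒞`: generalized shifts `σ_ψ : Y^Γ → Y^Γ` with `Y` a nontrivial finite discrete
group, `Γ` nonempty, and `ψ` and `σ_ψ` both finite fibre. -/
structure ShiftClass where
  Y : Type u
  Γ : Type v
  [group : Group Y]
  [finite : Finite Y]
  [nontrivial : Nontrivial Y]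
  [topology : TopologicalSpace Y]
  [discrete : DiscreteTopology Y]
  [nonempty : Nonempty Γ]
  ψ : Γ → Γ
  finiteFibre_map : FiniteFibre ψ
  finiteFibre_shift : FiniteFibre (shift Y ψ)

attribute [instance] ShiftClass.group ShiftClass.finite ShiftClass.nontrivial
  ShiftClass.topology ShiftClass.discrete ShiftClass.nonempty

/-- The four entropies that are compared. -/
inductive EntropyKind
  | top
  | alg
  | cset
  | set

/-- The value of each of the four entropies on a member of the class. -/
def ShiftClass.ent (s : ShiftClass.{u, v}) : EntropyKind → ℝ≥0∞
  | .top => topEntropy (shift s.Y s.ψ)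
  | .alg => algEntropy (shiftSum s.Y s.ψ s.finiteFibre_map)
  | .cset => csetEntropy (shift s.Y s.ψ)
  | .set => setEntropy (shift s.Y s.ψ)

/-- The comparison table; row `p`, column `q`; `true` is the check mark, `false` the cross. -/
def tableMark : EntropyKind → EntropyKind → Bool
  | .top, .top => true
  | .top, .alg => false
  | .top, .cset => true
  | .top, .set => true
  | .alg, .top => false
  | .alg, .alg => true
  | .alg, .cset => false
  | .alg, .set => true
  | .cset, .top => false
  | .cset, .alg => false
  | .cset, .cset => true
  | .cset, .set => true
  | .set, .top => false
  | .set, .alg => false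
  | .set, .cset => false
  | .set, .set => true

/-! ### The three self-maps of `ℤ` -/

/-- Two infinite chains running into the fixed point `0`. -/
def lambda1 (n : ℤ) : ℤ :=
  if 1 ≤ n then n - 1 else if n = 0 then 0 else n + 1

/-- Two infinite chains running off to infinity, and the fixed point `0`. -/
def lambda2 (n : ℤ) : ℤ :=
  if 1 ≤ n then n + 1 else if n = 0 then 0 else n - 1

open Classical in
/-- An infinite chain `⋯ → -2 → -1 → 0` into the fixed point `0`, and chains
`2 → 3`, `4 → 5 → 6`, `7 → 8 → 9 → 10`, … of growing length, each ending in a fixed point which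
is a triangular number. The image of `1` is the parameter `c`. -/
def lambda3 (c : ℤ) (n : ℤ) : ℤ :=
  if n = 1 then c else if ∃ k : ℤ, 2 * n = k * (k + 1) then n else n + 1

theorem finiteFibre_lambda1 : FiniteFibre lambda1 := by
  intro b
  refine (Set.finite_Icc (b - 1) (b + 1)).subset ?_
  intro n hn
  simp only [mem_preimage, mem_singleton_iff, lambda1] at hn
  simp only [mem_Icc]
  split_ifs at hn <;> omega

theorem finiteFibre_lambda2 : FiniteFibre lambda2 := by
  intro b
  refine (Set.finite_Icc (b - 1) (b + 1)).subset ?_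
  intro n hn
  simp only [mem_preimage, mem_singleton_iff, lambda2] at hn
  simp only [mem_Icc]
  split_ifs at hn <;> omega

theorem finiteFibre_lambda3 (c : ℤ) : FiniteFibre (lambda3 c) := by
  intro b
  refine ((Set.finite_Icc (b - 1) b).union (Set.finite_singleton 1)).subset ?_
  intro n hn
  simp only [mem_preimage, mem_singleton_iff, lambda3] at hn
  simp only [mem_union, mem_Icc, mem_singleton_iff]
  split_ifs at hn <;> omega

/-- `log |G|` as an extended nonnegative real. -/
def logCard (G : Type*) : ℝ≥0∞ := ENNReal.ofReal (Real.log (Nat.card G))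

end GenShift

end

namespace GenShift

/-! ### Growth rates -/

/-! Write `φ` for the index map. The topological entropy of its shift is governed by how many
coordinates the forward orbits of a finite set visit, the algebraic entropy by how many lie in
iterated preimages of a finite set; each new coordinate is worth `log |Y|`. These counts give upper
bounds, and disjoint infinite chains, forward or backward, give matching lower bounds
(`le_topEntropy_shift`, `le_algEntropy_shiftSum`).

The inequalities come from dichotomies. If `φ` has an injective orbit, then the contravariant
entropy is infinite (`csetEntropy_shift_eq_top`); otherwise every orbit of `φ` is finite and the
topological entropy vanishes. Hence top ≤ cset. If `φ^[m + p] = φ^[m]` for some `m` and `p > 0`,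
then the algebraic and contravariant entropies vanish; otherwise the set entropy is infinite
(`setEntropy_shift_eq_top`), so it dominates everything. That last claim is the core. Quasi-periodic
families form a subgroup of `Y^Γ`; Baire category shows that it is proper, a coset argument that its
complement is uncountable, and finite fibres then allow infinitely many disjoint infinite orbits to
be chosen.

The crosses come from two chains running into a fixed point (algebraic entropy without topological
or contravariant) and two running to infinity (the opposite). -/

theorem limsup_log_le {c : ℕ → ℕ} {B k M : ℕ} (h : ∀ n, c n ≤ B ^ (k * n + M)) :
    limsup (fun n : ℕ => ENNReal.ofReal (Real.log (c n) / n)) atTop ≤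
      k * ENNReal.ofReal (Real.log B) := by
  have hlim : Tendsto (fun n : ℕ => ENNReal.ofReal (((k : ℝ) + M / n) * Real.log B)) atTop
      (nhds (ENNReal.ofReal (((k : ℝ) + 0) * Real.log B))) := by
    refine ENNReal.tendsto_ofReal (Tendsto.mul_const _ (Tendsto.const_add _ ?_))
    exact tendsto_const_div_atTop_nhds_zero_nat _
  have hlog : 0 ≤ Real.log B := Real.log_natCast_nonneg B
  calc _ ≤ limsup (fun n : ℕ => ENNReal.ofReal (((k : ℝ) + M / n) * Real.log B)) atTop := by
        refine limsup_le_limsup ?_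
        filter_upwards [eventually_gt_atTop 0] with n hn
        apply ENNReal.ofReal_le_ofReal
        have hn' : (0 : ℝ) < n := by exact_mod_cast hn
        rw [div_le_iff₀ hn']
        have h1 : Real.log (c n) ≤ (k * n + M) * Real.log B := by
          rcases Nat.eq_zero_or_pos (c n) with h0 | h0
          · rw [h0]; simp only [Nat.cast_zero, Real.log_zero]; positivity
          · have := Real.log_le_log (by exact_mod_cast h0) (Nat.cast_le (α := ℝ).2 (h n))
            simpa [Real.log_pow] using this
        calc _ ≤ _ := h1
          _ = _ := by field_simp
    _ = _ := by
        rw [hlim.limsup_eq, add_zero, ENNReal.ofReal_mul (by positivity), ENNReal.ofReal_natCast]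

theorem le_limsup_log {c : ℕ → ℕ} {B k : ℕ} (hB : 1 ≤ B) (h : ∀ n, B ^ (k * n) ≤ c n) :
    k * ENNReal.ofReal (Real.log B) ≤
      limsup (fun n : ℕ => ENNReal.ofReal (Real.log (c n) / n)) atTop := by
  calc (k : ℝ≥0∞) * ENNReal.ofReal (Real.log B)
      = limsup (fun _ : ℕ => (k : ℝ≥0∞) * ENNReal.ofReal (Real.log B)) atTop := by simp
    _ ≤ _ := by
        refine limsup_le_limsup ?_
        filter_upwards [eventually_gt_atTop 0] with n hn
        have hn' : (0 : ℝ) < n := by exact_mod_cast hn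
        rw [← ENNReal.ofReal_natCast k, ← ENNReal.ofReal_mul (by positivity)]
        apply ENNReal.ofReal_le_ofReal
        rw [le_div_iff₀ hn']
        have := Real.log_le_log (x := ((B ^ (k * n) : ℕ) : ℝ)) (by positivity)
          (Nat.cast_le (α := ℝ).2 (h n))
        simp only [Nat.cast_pow, Real.log_pow, Nat.cast_mul] at this
        linarith

theorem limsup_encard_div_eq_zero {A : Type*} {S : ℕ → Set A} {E : Set A} (hE : E.Finite)
    (h : ∀ n, S n ⊆ E) :
    limsup (fun n : ℕ => ((S n).encard : ℝ≥0∞) / (n : ℝ≥0∞)) atTop = 0 := by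
  have hE' : ((E.encard : ℕ∞) : ℝ≥0∞) ≠ ⊤ := by
    simpa using hE
  have hlim : Tendsto (fun n : ℕ => (E.encard : ℝ≥0∞) / (n : ℝ≥0∞)) atTop (nhds 0) :=
    ENNReal.Tendsto.const_div ENNReal.tendsto_nat_nhds_top (Or.inr hE') |>.trans (by simp)
  refine le_antisymm ?_ bot_le
  rw [← hlim.limsup_eq]
  refine limsup_le_limsup (Eventually.of_forall fun n => ?_)
  have := encard_le_encard (h n)
  dsimp only
  gcongr

/-- The first `n` terms of `N` disjoint sequences of distinct points already provide `N * n`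
elements. -/
theorem le_limsup_encard_div {A : Type*} {S : ℕ → Set A} {N : ℕ} {x : ℕ → ℕ → A}
    (hx : Function.Injective fun q : ℕ × ℕ => x q.1 q.2)
    (h : ∀ n, ∀ s < N, ∀ i < n, x s i ∈ S n) :
    (N : ℝ≥0∞) ≤ limsup (fun n : ℕ => ((S n).encard : ℝ≥0∞) / (n : ℝ≥0∞)) atTop := by
  calc (N : ℝ≥0∞) = limsup (fun _ : ℕ => (N : ℝ≥0∞)) atTop := by simp
    _ ≤ _ := by
        refine limsup_le_limsup ?_
        filter_upwards [eventually_gt_atTop 0] with n hn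
        rw [ENNReal.le_div_iff_mul_le (Or.inl (by simp [hn.ne'])) (Or.inl (by simp))]
        have h1 : (fun q : ℕ × ℕ => x q.1 q.2) ''
            (Finset.range N ×ˢ Finset.range n : Finset (ℕ × ℕ)) ⊆ S n := by
          rintro _ ⟨⟨s, i⟩, hq, rfl⟩
          simp only [SetLike.mem_coe, Finset.mem_product, Finset.mem_range] at hq
          exact h n s hq.1 i hq.2
        have h2 := encard_le_encard h1
        rw [hx.encard_image, encard_coe_eq_coe_finsetCard] at h2
        simp only [Finset.card_product, Finset.card_range] at h2
        have h3 : (((N * n : ℕ) : ℕ∞) : ℝ≥0∞) ≤ ((S n).encard : ℝ≥0∞) := by gcongr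
        simpa using h3

/-! ### Criteria for infinite or zero set-theoretical entropies -/

theorem setEntropy_eq_top {A : Type*} {g : A → A} {x : ℕ → ℕ → A}
    (hx : Function.Injective fun q : ℕ × ℕ => x q.1 q.2) (hg : ∀ s i, g^[i] (x s 0) = x s i) :
    setEntropy g = ⊤ := by
  refine ENNReal.eq_top_of_forall_nnreal_le fun r => ?_
  obtain ⟨N, hN⟩ := exists_nat_ge r
  refine le_trans (b := (N : ℝ≥0∞)) (by exact_mod_cast hN) ?_
  refine le_trans ?_ (le_iSup₂ (f := fun (D : Set A) (_ : D.Finite) => setEntropyAt g D)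
    ((fun s => x s 0) '' Iio N) ((finite_Iio N).image _))
  refine le_limsup_encard_div hx fun n s hs i hi => ?_
  exact mem_iUnion₂.2 ⟨i, hi, x s 0, ⟨s, hs, rfl⟩, hg s i⟩

/-- Infinite backward strings stay inside the surjective cover, since each point has ancestors of
every order on its own string. Their starting points therefore have linearly growing preimages even
after restriction. -/
theorem csetEntropy_eq_top {A : Type*} {k : A → A} {x : ℕ → ℕ → A}
    (hx : Function.Injective fun q : ℕ × ℕ => x q.1 q.2) (hk : ∀ s i, k (x s (i + 1)) = x s i) :
    csetEntropy k = ⊤ := by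
  have hit : ∀ n s i, k^[n] (x s (i + n)) = x s i := by
    intro n
    induction n with
    | zero => simp
    | succ n ih => intro s i; rw [Function.iterate_succ_apply, ← add_assoc, hk, ih]
  have hsc : ∀ s i, x s i ∈ surjCover k := fun s i =>
    mem_iInter₂.2 fun n _ => ⟨_, hit n s i⟩
  let z : ℕ → ℕ → surjCover k := fun s i => ⟨x s i, hsc s i⟩
  have hz : Function.Injective fun q : ℕ × ℕ => z q.1 q.2 := fun q q' h =>
    hx (congrArg Subtype.val h)
  refine ENNReal.eq_top_of_forall_nnreal_le fun r => ?_
  obtain ⟨N, hN⟩ := exists_nat_ge r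
  refine le_trans (b := (N : ℝ≥0∞)) (by exact_mod_cast hN) ?_
  refine le_trans ?_ (le_iSup₂ (f := fun (D : Set (surjCover k)) (_ : D.Finite) =>
    csetEntropyAt (mapsTo_surjCover k).restrict D)
    ((fun s => z s 0) '' Iio N) ((finite_Iio N).image _))
  refine le_limsup_encard_div hz fun n s hs i hi => ?_
  refine mem_iUnion₂.2 ⟨i, hi, s, hs, ?_⟩
  apply Subtype.ext
  rw [MapsTo.iterate_restrict]
  simpa using (hit i s 0).symm

theorem csetEntropyOnto_eq_zero {A : Type*} {g : A → A} {p : ℕ} (hp : 0 < p)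
    (hg : ∀ x, g^[p] x = x) : csetEntropyOnto g = 0 := by
  refine le_antisymm (iSup₂_le fun D hD => le_of_eq ?_) bot_le
  refine limsup_encard_div_eq_zero (E := ⋃ j ∈ Finset.range p, g^[j] '' D)
    ((Finset.range p).finite_toSet.biUnion fun j _ => hD.image _) fun n x hx => ?_
  obtain ⟨i, -, hi⟩ := mem_iUnion₂.1 hx
  refine mem_iUnion₂.2 ⟨(p - i % p) % p, Finset.mem_range.2 (Nat.mod_lt _ hp), g^[i] x, hi, ?_⟩
  have hper : Function.IsPeriodicPt g p x := hg x
  rw [← Function.iterate_add_apply]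
  have hdvd : p ∣ (p - i % p) % p + i := by
    have := Nat.mod_lt i hp
    rw [← Nat.modEq_zero_iff_dvd, Nat.ModEq, Nat.mod_add_mod, ← Nat.add_mod_mod,
      Nat.sub_add_cancel this.le]
    simp
  exact (hper.trans_dvd hdvd)

/-! ### Iterates of shifts -/

theorem shift_iterate {Γ : Type*} (Y : Type*) (φ : Γ → Γ) (n : ℕ) (x : Γ → Y) (α : Γ) :
    (shift Y φ)^[n] x α = x (φ^[n] α) := by
  induction n generalizing α with
  | zero => rfl
  | succ n ih =>
    rw [Function.iterate_succ_apply', Function.iterate_succ_apply]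
    exact ih _

theorem FiniteFibre.preimage {A B : Type*} {g : A → B} (hg : FiniteFibre g) {s : Set B}
    (hs : s.Finite) : (g ⁻¹' s).Finite :=
  hs.preimage' fun b _ => hg b

theorem FiniteFibre.preimage_iterate {A : Type*} {g : A → A} (hg : FiniteFibre g) {s : Set A}
    (hs : s.Finite) (n : ℕ) : (g^[n] ⁻¹' s).Finite := by
  induction n with
  | zero => exact hs
  | succ n ih => rw [Function.iterate_succ, preimage_comp]; exact hg.preimage ih

/-- The image of a family under the shift determines it on `range φ`; only the coordinates outside
are free. -/
theorem finiteFibre_shift {Γ Y : Type*} [Finite Y] {φ : Γ → Γ} (h : (range φ)ᶜ.Finite) :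
    FiniteFibre (shift Y φ) := by
  intro y
  have := h.to_subtype
  refine Finite.of_finite_image (f := fun x (i : ((range φ)ᶜ : Set Γ)) => x i)
    (toFinite _) fun x hx x' hx' hxx => ?_
  funext α
  by_cases hα : α ∈ range φ
  · obtain ⟨β, rfl⟩ := hα
    exact (congrFun (hx : shift Y φ x = y) β).trans (congrFun (hx' : shift Y φ x' = y) β).symm
  · exact congrFun hxx ⟨α, hα⟩

/-! ### Topological entropy of shifts -/

theorem exists_cylinder_subset {Γ Y : Type*} [TopologicalSpace Y] {V : Set (Γ → Y)}
    (hV : IsOpen V) {x : Γ → Y} (hx : x ∈ V) :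
    ∃ F : Finset Γ, ∀ y : Γ → Y, (∀ i ∈ F, y i = x i) → y ∈ V := by
  obtain ⟨F, u, hu, hF⟩ := isOpen_pi_iff.1 hV x hx
  refine ⟨F, fun y hy => hF fun i hi => ?_⟩
  rw [hy i hi]
  exact (hu i hi).2

/-- A Lebesgue number lemma for cylinders, by compactness of `Y^Γ`. -/
theorem exists_uniform_cylinder {Γ Y : Type*} [TopologicalSpace Y] [DiscreteTopology Y]
    [Finite Y] {U : Set (Set (Γ → Y))} (hU : ∀ V ∈ U, IsOpen V) (hc : ⋃₀ U = univ) :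
    ∃ F : Finset Γ, ∀ x : Γ → Y, ∃ V ∈ U, ∀ y : Γ → Y, (∀ i ∈ F, y i = x i) → y ∈ V := by
  classical
  have h1 : ∀ x : Γ → Y, ∃ V ∈ U, ∃ F : Finset Γ, ∀ y : Γ → Y, (∀ i ∈ F, y i = x i) → y ∈ V := by
    intro x
    obtain ⟨V, hV, hx⟩ := mem_sUnion.1 (hc ▸ mem_univ x)
    exact ⟨V, hV, exists_cylinder_subset (hU V hV) hx⟩
  choose V hV F hF using h1
  have hopen : ∀ x : Γ → Y, IsOpen {y : Γ → Y | ∀ i ∈ F x, y i = x i} := by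
    intro x
    have : {y : Γ → Y | ∀ i ∈ F x, y i = x i} =
        ⋂ i ∈ F x, (fun y : Γ → Y => y i) ⁻¹' {x i} := by ext; simp
    rw [this]
    exact isOpen_biInter_finset fun i _ => (isOpen_discrete _).preimage (continuous_apply i)
  obtain ⟨t, ht⟩ := isCompact_univ.elim_finite_subcover _ hopen
    (fun x _ => mem_iUnion.2 ⟨x, fun _ _ => rfl⟩)
  refine ⟨t.biUnion F, fun x => ?_⟩
  obtain ⟨z, hz, hxz⟩ := mem_iUnion₂.1 (ht (mem_univ x))
  refine ⟨V z, hV z, fun y hy => hF z y fun i hi => ?_⟩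
  rw [hy i (Finset.mem_biUnion.2 ⟨z, hz, hi⟩), hxz i hi]

/-- The coordinates in `E` determine the `F`-coordinates of the first `n` iterates, hence one member
of the join for each pattern on `E`. -/
theorem coverNumber_le {Γ Y : Type*} [Finite Y] [Nonempty Y] {φ : Γ → Γ}
    {U : Set (Set (Γ → Y))} {F : Finset Γ}
    (hF : ∀ x : Γ → Y, ∃ V ∈ U, ∀ y : Γ → Y, (∀ i ∈ F, y i = x i) → y ∈ V) {n : ℕ} {E : Finset Γ}
    (hE : ∀ i < n, ∀ α ∈ F, φ^[i] α ∈ E) :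
    coverNumber (iteratedJoin (shift Y φ) U n) ≤ Nat.card Y ^ E.card := by
  classical
  obtain ⟨y₀⟩ := ‹Nonempty Y›
  choose V hV hVF using hF
  let ext : (E → Y) → Γ → Y := fun f α => if h : α ∈ E then f ⟨α, h⟩ else y₀
  let W : (E → Y) → Set (Γ → Y) := fun f =>
    ⋂ i < n, (shift Y φ)^[i] ⁻¹' V ((shift Y φ)^[i] (ext f))
  have hcover : ⋃₀ range W = univ := by
    refine eq_univ_of_forall fun x => ?_
    refine mem_sUnion.2 ⟨_, ⟨fun a => x a, rfl⟩, mem_iInter₂.2 fun i hi => hVF _ _ fun α hα => ?_⟩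
    have hα' := hE i hi α hα
    simp only [shift_iterate, ext, hα', dif_pos]
  calc coverNumber (iteratedJoin (shift Y φ) U n) ≤ (range W).ncard := by
        refine Nat.sInf_le ⟨range W, ?_, finite_range W, hcover, rfl⟩
        rintro _ ⟨f, rfl⟩
        exact ⟨fun i => V ((shift Y φ)^[i] (ext f)), fun i => hV _, rfl⟩
    _ ≤ Nat.card (E → Y) := by
        rw [← image_univ, ← ncard_univ]
        exact ncard_image_le finite_univ
    _ = Nat.card Y ^ E.card := by simp [Nat.card_fun]

theorem topEntropy_shift_le {Γ Y : Type*} [TopologicalSpace Y] [DiscreteTopology Y] [Finite Y]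
    [Nonempty Y] {φ : Γ → Γ} {k : ℕ}
    (h : ∀ F : Finset Γ, ∃ M : ℕ, ∀ n, ∃ E : Finset Γ, E.card ≤ k * n + M ∧
      ∀ i < n, ∀ α ∈ F, φ^[i] α ∈ E) :
    topEntropy (shift Y φ) ≤ k * logCard Y := by
  refine iSup₂_le fun U ⟨_, hU, hc⟩ => ?_
  obtain ⟨F, hF⟩ := exists_uniform_cylinder hU hc
  obtain ⟨M, hM⟩ := h F
  refine limsup_log_le (M := M) fun n => ?_
  obtain ⟨E, hEc, hE⟩ := hM n
  exact (coverNumber_le hF hE).trans (Nat.pow_le_pow_right Nat.card_pos hEc)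

theorem finite_iteratedJoin {Z : Type*} {T : Z → Z} {U : Set (Set Z)} (hU : U.Finite) (n : ℕ) :
    (iteratedJoin T U n).Finite := by
  have := hU.to_subtype
  refine (finite_range fun f : Fin n → U => ⋂ i : Fin n, T^[i] ⁻¹' (f i : Set Z)).subset ?_
  rintro _ ⟨f, hf, rfl⟩
  refine ⟨fun i => ⟨f i, hf i⟩, ?_⟩
  ext z
  simp [Fin.forall_iff]

theorem sUnion_iteratedJoin {Z : Type*} {T : Z → Z} {U : Set (Set Z)} (hU : ⋃₀ U = univ)
    (n : ℕ) : ⋃₀ iteratedJoin T U n = univ := by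
  refine eq_univ_of_forall fun z => ?_
  have h : ∀ i : ℕ, ∃ V ∈ U, T^[i] z ∈ V := fun i => mem_sUnion.1 (hU ▸ mem_univ (T^[i] z))
  choose V hV hz using h
  exact mem_sUnion.2 ⟨_, ⟨V, hV, rfl⟩, mem_iInter₂.2 fun i _ => hz i⟩

/-- Pigeonhole: no member of the cover contains two of the separated points. -/
theorem le_coverNumber {Z P : Type*} {U : Set (Set Z)} (hfin : U.Finite) (hc : ⋃₀ U = univ)
    (x : P → Z) (hx : ∀ V ∈ U, ∀ p q, x p ∈ V → x q ∈ V → p = q) :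
    Nat.card P ≤ coverNumber U := by
  have hne : {m : ℕ | ∃ W : Set (Set Z), W ⊆ U ∧ W.Finite ∧ ⋃₀ W = univ ∧ W.ncard = m}.Nonempty :=
    ⟨_, U, Subset.rfl, hfin, hc, rfl⟩
  obtain ⟨W, hWU, hW, hWc, hcard⟩ := Nat.sInf_mem hne
  rw [coverNumber, ← hcard]
  have h : ∀ p, ∃ V ∈ W, x p ∈ V := fun p => mem_sUnion.1 (hWc ▸ mem_univ (x p))
  choose V hV hxV using h
  have := hW.to_subtype
  rw [← Nat.card_coe_set_eq]
  refine Nat.card_le_card_of_injective (fun p => (⟨V p, hV p⟩ : W)) fun p q hpq => ?_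
  have hpq' : V p = V q := congrArg Subtype.val hpq
  exact hx _ (hWU (hV p)) p q (hxV p) (hpq' ▸ hxV q)

theorem le_topEntropy_shift {Γ Y ι : Type*} [TopologicalSpace Y] [DiscreteTopology Y] [Finite Y]
    [Nonempty Y] [Finite ι] {φ : Γ → Γ} {a : ι → ℕ → Γ}
    (ha : Function.Injective fun q : ι × ℕ => a q.1 q.2) (hφ : ∀ s i, φ (a s i) = a s (i + 1)) :
    Nat.card ι * logCard Y ≤ topEntropy (shift Y φ) := by
  classical
  obtain ⟨y₀⟩ := ‹Nonempty Y›
  have hit : ∀ s i, φ^[i] (a s 0) = a s i := by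
    intro s i
    induction i with
    | zero => rfl
    | succ i ih => rw [Function.iterate_succ_apply', ih, hφ]
  -- This cover reads the values at the chain heads; iterating the shift reads them further along
  -- the chains.
  let C : (ι → Y) → Set (Γ → Y) := fun f => {x | ∀ s, x (a s 0) = f s}
  have hC : (range C).Finite ∧ (∀ V ∈ range C, IsOpen V) ∧ ⋃₀ range C = univ := by
    refine ⟨finite_range C, ?_, eq_univ_of_forall fun x =>
      mem_sUnion.2 ⟨_, ⟨fun s => x (a s 0), rfl⟩, fun _ => rfl⟩⟩
    rintro _ ⟨f, rfl⟩
    have : C f = ⋂ s, (fun x : Γ → Y => x (a s 0)) ⁻¹' {f s} := by ext; simp [C]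
    rw [this]
    exact isOpen_iInter_of_finite fun s => (isOpen_discrete _).preimage (continuous_apply _)
  refine le_trans ?_ (le_iSup₂ (f := fun (U : Set (Set (Γ → Y)))
    (_ : U.Finite ∧ (∀ V ∈ U, IsOpen V) ∧ ⋃₀ U = univ) => topEntropyAt (shift Y φ) U) (range C) hC)
  refine le_limsup_log Nat.card_pos fun n => ?_
  let x : (ι × Fin n → Y) → Γ → Y := fun f γ =>
    if h : ∃ q : ι × Fin n, a q.1 q.2 = γ then f h.choose else y₀
  have hxa : ∀ f (q : ι × Fin n), x f (a q.1 q.2) = f q := by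
    intro f q
    have h : ∃ q' : ι × Fin n, a q'.1 q'.2 = a q.1 q.2 := ⟨q, rfl⟩
    have h1 : h.choose = q := by
      have h2 := @ha (h.choose.1, h.choose.2) (q.1, q.2) h.choose_spec
      rw [Prod.mk.injEq] at h2
      exact Prod.ext h2.1 (Fin.ext h2.2)
    simp only [x, dif_pos h, h1]
  calc Nat.card Y ^ (Nat.card ι * n) = Nat.card (ι × Fin n → Y) := by
        simp [Nat.card_fun, Nat.card_prod]
    _ ≤ _ := by
        refine le_coverNumber (finite_iteratedJoin hC.1 n) (sUnion_iteratedJoin hC.2.2 n) x ?_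
        rintro _ ⟨f, hf, rfl⟩ p q hp hq
        funext ⟨s, i⟩
        obtain ⟨c, hc⟩ := hf i
        have hp' := mem_iInter₂.1 hp i i.2
        have hq' := mem_iInter₂.1 hq i i.2
        rw [← hc] at hp' hq'
        have h1 := hp' s
        have h2 := hq' s
        rw [shift_iterate, hit] at h1 h2
        rw [← hxa p (s, i), ← hxa q (s, i)]
        exact h1.trans h2.symm

/-! ### Algebraic entropy of shifts -/

/-- The families supported in a given set, as a subgroup of the direct sum. -/
def supportedIn {Γ : Type*} (Y : Type*) [Group Y] (E : Set Γ) : Subgroup (finSum Γ Y) where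
  carrier := {x | ∀ α ∉ E, (x : Γ → Y) α = 1}
  mul_mem' := by
    intro x y hx hy α hα
    simp [hx α hα, hy α hα]
  one_mem' := fun _ _ => rfl
  inv_mem' := by
    intro x hx α hα
    simp [hx α hα]

theorem supportedIn_restrict_injective {Γ Y : Type*} [Group Y] (E : Set Γ) :
    Function.Injective fun (x : supportedIn Y E) (α : E) => (x : finSum Γ Y).1 α := by
  intro x y h
  refine Subtype.ext (Subtype.ext (funext fun α => ?_))
  by_cases hα : α ∈ E
  · exact congrFun h ⟨α, hα⟩
  · exact (x.2 α hα).trans (y.2 α hα).symm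

theorem finite_supportedIn {Γ Y : Type*} [Group Y] [Finite Y] {E : Set Γ} (hE : E.Finite) :
    (supportedIn Y E : Set (finSum Γ Y)).Finite := by
  have := hE.to_subtype
  have := Finite.of_injective _ (supportedIn_restrict_injective (Y := Y) E)
  exact toFinite _

theorem ncard_supportedIn_le {Γ Y : Type*} [Group Y] [Finite Y] (E : Finset Γ) :
    (supportedIn Y (E : Set Γ) : Set (finSum Γ Y)).ncard ≤ Nat.card Y ^ E.card := by
  rw [← Nat.card_coe_set_eq]
  refine (Nat.card_le_card_of_injective _ (supportedIn_restrict_injective (Y := Y) _)).trans ?_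
  simp [Nat.card_fun]

theorem exists_le_supportedIn {Γ Y : Type*} [Group Y] {H : Set (finSum Γ Y)}
    (hH : H.Finite) : ∃ F : Finset Γ, H ⊆ supportedIn Y (F : Set Γ) := by
  have : (⋃ x ∈ H, {α | (x : Γ → Y) α ≠ 1}).Finite := hH.biUnion fun x _ => x.2
  refine ⟨this.toFinset, fun x hx α hα => ?_⟩
  by_contra h
  exact hα (by simpa using ⟨x.1, ⟨x.2, hx⟩, h⟩)

theorem shiftSum_iterate {Γ Y : Type*} [Group Y] {φ : Γ → Γ} (hφ : FiniteFibre φ) (n : ℕ)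
    (x : finSum Γ Y) (α : Γ) :
    ((shiftSum Y φ hφ)^[n] x : Γ → Y) α = (x : Γ → Y) (φ^[n] α) := by
  induction n generalizing α with
  | zero => rfl
  | succ n ih =>
    rw [Function.iterate_succ_apply', Function.iterate_succ_apply]
    exact ih _

theorem trajectory_subset {K : Type*} [Group K] {θ : K →* K} {H : Set K} {L : Subgroup K} {n : ℕ}
    (h : ∀ i < n, θ^[i] '' H ⊆ L) : trajectory θ H n ⊆ L := by
  induction n with
  | zero => simp [trajectory, L.one_mem]
  | succ n ih =>
    rintro _ ⟨x, hx, y, hy, rfl⟩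
    exact L.mul_mem (ih (fun i hi => h i (by omega)) hx) (h n (by omega) hy)

theorem finite_trajectory {K : Type*} [Group K] {θ : K →* K} {H : Set K} (hH : H.Finite)
    (n : ℕ) : (trajectory θ H n).Finite := by
  induction n with
  | zero => simp [trajectory]
  | succ n ih => exact ih.mul (hH.image _)

/-- If `H` is supported in `F`, its `i`-th image is supported in the `i`-th preimage of `F`, so the
trajectory lies in the subgroup supported in `E`. -/
theorem algEntropy_shiftSum_le {Γ Y : Type*} [Group Y] [Finite Y] {φ : Γ → Γ}
    (hφ : FiniteFibre φ) {k : ℕ}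
    (h : ∀ F : Finset Γ, ∃ M : ℕ, ∀ n, ∃ E : Finset Γ, E.card ≤ k * n + M ∧
      ∀ i < n, ∀ α, φ^[i] α ∈ F → α ∈ E) :
    algEntropy (shiftSum Y φ hφ) ≤ k * logCard Y := by
  refine iSup₂_le fun H hH => ?_
  obtain ⟨F, hF⟩ := exists_le_supportedIn hH
  obtain ⟨M, hM⟩ := h F
  refine limsup_log_le (M := M) fun n => ?_
  obtain ⟨E, hEc, hE⟩ := hM n
  have hsub : trajectory (shiftSum Y φ hφ) (H : Set (finSum Γ Y)) n ⊆
      supportedIn Y (E : Set Γ) := by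
    refine trajectory_subset ?_
    rintro i hi _ ⟨x, hx, rfl⟩ α hα
    rw [shiftSum_iterate]
    exact hF hx _ fun hmem => hα (hE i hi α hmem)
  calc _ ≤ _ := ncard_le_ncard hsub (finite_supportedIn E.finite_toSet)
    _ ≤ _ := ncard_supportedIn_le E
    _ ≤ _ := Nat.pow_le_pow_right Nat.card_pos hEc

/-- Each chain point has the next one as its only preimage, so the shift carries a family supported
on the chain heads to one supported one step further. The trajectory of that subgroup thus fills all
patterns on the first `n` layers. -/
theorem le_algEntropy_shiftSum {Γ Y ι : Type*} [Group Y] [Finite Y] [Finite ι] {φ : Γ → Γ}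
    (hφ : FiniteFibre φ) {a : ι → ℕ → Γ}
    (ha : Function.Injective fun q : ι × ℕ => a q.1 q.2)
    (hpre : ∀ s i α, φ α = a s i ↔ α = a s (i + 1)) :
    Nat.card ι * logCard Y ≤ algEntropy (shiftSum Y φ hφ) := by
  classical
  have hit : ∀ n s α, φ^[n] α = a s 0 ↔ α = a s n := by
    intro n s
    induction n with
    | zero => simp
    | succ n ih => intro α; rw [Function.iterate_succ_apply, ih, hpre]
  have hF : (range fun s => a s 0).Finite := finite_range _
  refine le_trans ?_ (le_iSup₂ (f := fun (H : Subgroup (finSum Γ Y))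
    (_ : (H : Set (finSum Γ Y)).Finite) => algEntropyAt (shiftSum Y φ hφ) (H : Set (finSum Γ Y)))
    (supportedIn Y (range fun s => a s 0)) (finite_supportedIn hF))
  refine le_limsup_log Nat.card_pos fun n => ?_
  have hinj : ∀ s t i j, a s i = a t j → s = t ∧ i = j := fun s t i j h => by
    simpa using @ha (s, i) (t, j) h
  have hmem : ∀ n, ∀ x : finSum Γ Y, (∀ α, (∀ s, ∀ i < n, α ≠ a s i) → (x : Γ → Y) α = 1) →
      x ∈ trajectory (shiftSum Y φ hφ) (supportedIn Y (range fun s => a s 0) :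
        Set (finSum Γ Y)) n := by
    intro n
    induction n with
    | zero =>
      intro x hx
      refine Subtype.ext (funext fun α => hx α ?_)
      intro s i hi
      omega
    | succ n ih =>
      intro x hx
      -- Peel off the last layer: `u` is `x` with layer `n` erased, and `v` is that layer
      -- transported to the chain heads.
      let u : finSum Γ Y := ⟨fun α => if ∃ s, α = a s n then 1 else (x : Γ → Y) α,
        x.2.subset fun α hα => by
          by_contra h
          have h' : (x : Γ → Y) α = 1 := by simpa using h
          exact hα (by simp [h'])⟩
      let v : finSum Γ Y := ⟨fun α => if h : ∃ s, α = a s 0 then (x : Γ → Y) (a h.choose n) else 1,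
        hF.subset fun α hα => by
          by_contra h
          refine hα (dif_neg ?_)
          rintro ⟨s, rfl⟩
          exact h ⟨s, rfl⟩⟩
      refine ⟨u, ih u ?_, _, ⟨v, ?_, rfl⟩, ?_⟩
      · intro α hα
        by_cases h : ∃ s, α = a s n
        · simp [u, h]
        · simp only [u, if_neg h]
          refine hx α fun s i hi => ?_
          rcases Nat.lt_succ_iff_lt_or_eq.1 hi with hi | rfl
          · exact hα s i hi
          · exact fun hs => h ⟨s, hs⟩
      · intro α hα
        refine dif_neg ?_
        rintro ⟨s, rfl⟩
        exact hα ⟨s, rfl⟩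
      · refine Subtype.ext (funext fun α => ?_)
        change (u : Γ → Y) α * ((shiftSum Y φ hφ)^[n] v : Γ → Y) α = (x : Γ → Y) α
        rw [shiftSum_iterate]
        by_cases h : ∃ s, α = a s n
        · have h1 : ∃ s, φ^[n] α = a s 0 := by
            obtain ⟨s, hs⟩ := h
            exact ⟨s, (hit n s α).2 hs⟩
          have h2 : α = a h1.choose n := (hit n _ α).1 h1.choose_spec
          simp only [u, v, if_pos h, dif_pos h1, one_mul, ← h2]
        · have h1 : ¬ ∃ s, φ^[n] α = a s 0 := by
            rintro ⟨s, hs⟩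
            exact h ⟨s, (hit n s α).1 hs⟩
          simp only [u, v, if_neg h, dif_neg h1, mul_one]
  let x : (ι × Fin n → Y) → finSum Γ Y := fun f =>
    ⟨fun γ => if h : ∃ q : ι × Fin n, a q.1 q.2 = γ then f h.choose else 1,
      (finite_range fun q : ι × Fin n => a q.1 q.2).subset fun α hα => by
        by_contra h
        exact hα (dif_neg h)⟩
  have hxa : ∀ f (q : ι × Fin n), (x f : Γ → Y) (a q.1 q.2) = f q := by
    intro f q
    have h : ∃ q' : ι × Fin n, a q'.1 q'.2 = a q.1 q.2 := ⟨q, rfl⟩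
    have h1 : h.choose = q := by
      have h2 := hinj _ _ _ _ h.choose_spec
      exact Prod.ext h2.1 (Fin.ext h2.2)
    simp only [x, dif_pos h, h1]
  have hxinj : Function.Injective x := fun f g hfg => funext fun q => by
    rw [← hxa f q, ← hxa g q, hfg]
  calc Nat.card Y ^ (Nat.card ι * n) = Nat.card (ι × Fin n → Y) := by
        simp [Nat.card_fun, Nat.card_prod]
    _ = (range x).ncard := by
        rw [← image_univ, ncard_image_of_injective _ hxinj, ncard_univ]
    _ ≤ _ := by
        refine ncard_le_ncard ?_ (finite_trajectory (finite_supportedIn hF) n)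
        rintro _ ⟨f, rfl⟩
        refine hmem n _ fun α hα => dif_neg ?_
        rintro ⟨⟨s, i⟩, rfl⟩
        exact hα s i i.2 rfl

/-! ### Quasi-periodic maps and infinite orbits -/

theorem exists_lt_iterate_eq {A : Type*} {f : A → A} {x : A} {m p : ℕ} (hp : 0 < p)
    (h : f^[m + p] x = f^[m] x) (n : ℕ) : ∃ k < m + p, f^[n] x = f^[k] x := by
  induction n using Nat.strong_induction_on with
  | _ n ih =>
    rcases lt_or_ge n (m + p) with hn | hn
    · exact ⟨n, hn, rfl⟩
    · obtain ⟨l, rfl⟩ := Nat.exists_eq_add_of_le' hn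
      obtain ⟨k, hk, hkx⟩ := ih (l + m) (by omega)
      refine ⟨k, hk, ?_⟩
      rw [← hkx, Function.iterate_add_apply, h, ← Function.iterate_add_apply]

theorem finite_orbit {A : Type*} {f : A → A} {x : A} {m p : ℕ} (hp : 0 < p)
    (h : f^[m + p] x = f^[m] x) : (range fun n => f^[n] x).Finite := by
  refine ((finite_Iio (m + p)).image fun n => f^[n] x).subset ?_
  rintro _ ⟨n, rfl⟩
  obtain ⟨k, hk, hkx⟩ := exists_lt_iterate_eq hp h n
  exact ⟨k, hk, hkx.symm⟩

theorem exists_iterate_eq_of_not_injective {A : Type*} {f : A → A} {x : A}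
    (h : ¬ Function.Injective fun n => f^[n] x) :
    ∃ m p, 0 < p ∧ f^[m + p] x = f^[m] x := by
  simp only [Function.Injective, not_forall] at h
  obtain ⟨i, j, hij, hne⟩ := h
  rcases lt_or_gt_of_ne hne with hlt | hlt
  · exact ⟨i, j - i, by omega, by rw [Nat.add_sub_cancel' hlt.le]; exact hij.symm⟩
  · exact ⟨j, i - j, by omega, by rw [Nat.add_sub_cancel' hlt.le]; exact hij⟩

theorem topEntropy_shift_eq_zero {Γ Y : Type*} [TopologicalSpace Y] [DiscreteTopology Y]
    [Finite Y] [Nonempty Y] {φ : Γ → Γ}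
    (h : ∀ α, ∃ m p, 0 < p ∧ φ^[m + p] α = φ^[m] α) :
    topEntropy (shift Y φ) = 0 := by
  have h0 : topEntropy (shift Y φ) ≤ (0 : ℕ) * logCard Y := by
    refine topEntropy_shift_le fun F => ?_
    have hfin : (⋃ α ∈ F, range fun n => φ^[n] α).Finite := F.finite_toSet.biUnion fun α _ => by
      obtain ⟨m, p, hp, hα⟩ := h α
      exact finite_orbit hp hα
    refine ⟨hfin.toFinset.card, fun n => ⟨hfin.toFinset, by omega, fun i _ α hα => ?_⟩⟩
    rw [Finite.mem_toFinset]
    exact mem_iUnion₂.2 ⟨α, hα, i, rfl⟩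
  simpa using h0

theorem csetEntropy_shift_eq_top {Γ Y : Type*} [Nontrivial Y] {φ : Γ → Γ} {a : Γ}
    (ha : Function.Injective fun n => φ^[n] a) : csetEntropy (shift Y φ) = ⊤ := by
  classical
  obtain ⟨y₀, y₁, hy⟩ := exists_pair_ne Y
  -- Synchronous merging: the classes of the points `φ^[k] a` are distinct levels, and `φ` raises
  -- the level by exactly one.
  let R : Γ → Γ → Prop := fun α β => ∃ n, φ^[n] α = φ^[n] β
  have hR : ∀ α k, R (φ α) (φ^[k + 1] a) ↔ R α (φ^[k] a) := by
    intro α k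
    constructor
    · rintro ⟨n, hn⟩
      refine ⟨n + 1, ?_⟩
      rw [Function.iterate_succ_apply, hn, Function.iterate_succ_apply' φ k,
        ← Function.iterate_succ_apply]
    · rintro ⟨n, hn⟩
      refine ⟨n, ?_⟩
      rw [Function.iterate_succ_apply' φ k, ← Function.iterate_succ_apply,
        ← Function.iterate_succ_apply, Function.iterate_succ_apply', hn,
        Function.iterate_succ_apply']
  have hRa : ∀ i j, R (φ^[i] a) (φ^[j] a) ↔ i = j := by
    intro i j
    constructor
    · rintro ⟨n, hn⟩
      rw [← Function.iterate_add_apply, ← Function.iterate_add_apply] at hn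
      have := ha hn
      omega
    · rintro rfl
      exact ⟨0, rfl⟩
  -- The marked levels encode `i` by the lower one and `s` by the gap; shifting lowers both levels
  -- by one.
  let x : ℕ → ℕ → Γ → Y := fun s i γ =>
    if R γ (φ^[i + 1] a) ∨ R γ (φ^[i + 2 + s] a) then y₁ else y₀
  have hxval : ∀ s i j, x s i (φ^[j] a) = y₁ ↔ j = i + 1 ∨ j = i + 2 + s := by
    intro s i j
    simp only [x, hRa]
    split_ifs with h
    · simp [h]
    · simp [h, hy]
  refine csetEntropy_eq_top (x := x) ?_ fun s i => ?_
  · rintro ⟨s, i⟩ ⟨t, j⟩ h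
    have hiff : ∀ l, (l = i + 1 ∨ l = i + 2 + s) ↔ (l = j + 1 ∨ l = j + 2 + t) := fun l => by
      rw [← hxval, ← hxval]
      exact iff_of_eq (congrArg (fun z : Γ → Y => z (φ^[l] a) = y₁) h)
    have h1 := hiff (i + 1)
    have h2 := hiff (i + 2 + s)
    have h3 := hiff (j + 1)
    have h4 := hiff (j + 2 + t)
    rw [Prod.mk.injEq]
    omega
  · funext γ
    simp only [shift, x]
    rw [hR, show i + 1 + 2 + s = (i + 2 + s) + 1 by omega, hR]

theorem topEntropy_shift_le_csetEntropy {Γ Y : Type*} [TopologicalSpace Y] [DiscreteTopology Y]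
    [Finite Y] [Nontrivial Y] (φ : Γ → Γ) :
    topEntropy (shift Y φ) ≤ csetEntropy (shift Y φ) := by
  by_cases h : ∃ a, Function.Injective fun n => φ^[n] a
  · obtain ⟨a, ha⟩ := h
    rw [csetEntropy_shift_eq_top ha]
    exact le_top
  · rw [not_exists] at h
    rw [topEntropy_shift_eq_zero fun α => exists_iterate_eq_of_not_injective (h α)]
    exact bot_le

theorem algEntropy_shiftSum_eq_zero {Γ Y : Type*} [Group Y] [Finite Y] {φ : Γ → Γ}
    (hφ : FiniteFibre φ) {m p : ℕ} (hp : 0 < p) (h : ∀ α, φ^[m + p] α = φ^[m] α) :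
    algEntropy (shiftSum Y φ hφ) = 0 := by
  have h0 : algEntropy (shiftSum Y φ hφ) ≤ (0 : ℕ) * logCard Y := by
    refine algEntropy_shiftSum_le hφ fun F => ?_
    have hfin : (⋃ k ∈ Finset.range (m + p), φ^[k] ⁻¹' (F : Set Γ)).Finite :=
      (Finset.range (m + p)).finite_toSet.biUnion fun k _ =>
        hφ.preimage_iterate F.finite_toSet k
    refine ⟨hfin.toFinset.card, fun n => ⟨hfin.toFinset, by omega, fun i _ α hα => ?_⟩⟩
    obtain ⟨k, hk, hkα⟩ := exists_lt_iterate_eq hp (h α) i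
    rw [Finite.mem_toFinset]
    exact mem_iUnion₂.2 ⟨k, Finset.mem_range.2 hk, by rw [hkα] at hα; exact hα⟩
  simpa using h0

theorem csetEntropy_shift_eq_zero {Γ Y : Type*} {φ : Γ → Γ} {p : ℕ} (hp : 0 < p)
    (h : ∀ α, ∃ m, φ^[m + p] α = φ^[m] α) : csetEntropy (shift Y φ) = 0 := by
  refine csetEntropyOnto_eq_zero hp fun x => ?_
  apply Subtype.ext
  rw [MapsTo.iterate_restrict]
  change (shift Y φ)^[p] x.1 = x.1
  funext α
  obtain ⟨m, hm⟩ := h α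
  -- An ancestor of order `m + 1` makes `x α` a value of `y` beyond the preperiod of `α`; the extra
  -- one is needed because the surjective cover starts at `n = 1`.
  obtain ⟨y, hy⟩ := mem_iInter₂.1 x.2 (m + 1) (by omega)
  rw [shift_iterate, ← hy, shift_iterate, shift_iterate, ← Function.iterate_add_apply,
    show m + 1 + p = 1 + (m + p) by omega, add_comm m 1, Function.iterate_add_apply, hm,
    ← Function.iterate_add_apply]

/-- The families on which the shift is quasi-periodic. -/
def quasiPeriodic {Γ : Type*} (Y : Type*) [Group Y] (φ : Γ → Γ) : Subgroup (Γ → Y) where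
  carrier := {x | ∃ m p, 0 < p ∧ ∀ α, x (φ^[m + p] α) = x (φ^[m] α)}
  one_mem' := ⟨0, 1, one_pos, fun _ => rfl⟩
  inv_mem' := by
    rintro x ⟨m, p, hp, hx⟩
    exact ⟨m, p, hp, fun α => by simp [hx α]⟩
  mul_mem' := by
    -- The preperiod may be increased and the period multiplied, so two families share the preperiod
    -- `m + n` and the period `p * q`.
    have key : ∀ {x : Γ → Y} {m p : ℕ}, (∀ α, x (φ^[m + p] α) = x (φ^[m] α)) →
        ∀ i q α, x (φ^[i + m + q * p] α) = x (φ^[i + m] α) := by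
      intro x m p hx i q
      induction q with
      | zero => simp
      | succ q ih =>
        intro α
        rw [← ih α, show i + m + (q + 1) * p = (m + p) + (i + q * p) by ring,
          Function.iterate_add_apply, hx, ← Function.iterate_add_apply]
        congr 2
        ring_nf
    rintro x y ⟨m, p, hp, hx⟩ ⟨n, q, hq, hy⟩
    refine ⟨m + n, p * q, Nat.mul_pos hp hq, fun α => ?_⟩
    have h1 := key hx n q α
    have h2 := key hy m p α
    simp only [Pi.mul_apply]
    rw [h2, show m + n + p * q = n + m + q * p by ring, h1, add_comm n m]

/-- Baire category makes the exponents uniform on a cylinder. Free coordinates there turn equality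
of values into equality of indices, outside a finite set that is then treated pointwise. -/
theorem exists_iterate_eq_of_quasiPeriodic {Γ Y : Type*} [Group Y] [Finite Y] [Nontrivial Y]
    {φ : Γ → Γ} (hφ : FiniteFibre φ) (h : ∀ x, x ∈ quasiPeriodic Y φ) :
    ∃ m p, 0 < p ∧ ∀ α, φ^[m + p] α = φ^[m] α := by
  classical
  let _ : TopologicalSpace Y := ⊥
  have : DiscreteTopology Y := ⟨rfl⟩
  let S : ℕ × ℕ → Set (Γ → Y) := fun q => {x | ∀ α, x (φ^[q.1 + (q.2 + 1)] α) = x (φ^[q.1] α)}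
  have hclosed : ∀ q, IsClosed (S q) := fun q => by
    simp only [S, ofPred_forall]
    exact isClosed_iInter fun α => isClosed_eq (continuous_apply _) (continuous_apply _)
  have hunion : ⋃ q, S q = univ := eq_univ_of_forall fun x => by
    obtain ⟨m, p, hp, hx⟩ := h x
    refine mem_iUnion.2 ⟨(m, p - 1), fun α => ?_⟩
    rw [← hx α]
    simp only [Nat.sub_add_cancel hp]
  obtain ⟨⟨m, p'⟩, x, hx⟩ := nonempty_interior_of_iUnion_of_closed hclosed hunion
  obtain ⟨F, hF⟩ := exists_cylinder_subset isOpen_interior hx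
  obtain ⟨p, hp, rfl⟩ : ∃ p, 0 < p ∧ p' = p - 1 := ⟨p' + 1, by omega, by omega⟩
  have hV : ∀ y : Γ → Y, (∀ i ∈ F, y i = x i) → ∀ α, y (φ^[m + p] α) = y (φ^[m] α) := by
    intro y hy α
    have := interior_subset (hF y hy) α
    simpa only [Nat.sub_add_cancel hp] using this
  -- If `φ^[m] α` is not in `F`, changing that single coordinate stays in the cylinder and would
  -- break the equation at an exceptional `α`.
  have hE : {α | φ^[m + p] α ≠ φ^[m] α}.Finite := by
    refine (hφ.preimage_iterate F.finite_toSet m).subset fun α hα => ?_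
    by_contra hmem
    obtain ⟨b, hb⟩ := exists_ne (x (φ^[m] α))
    have h1 := hV (Function.update x (φ^[m] α) b) (fun i hi => by
      rw [Function.update_of_ne]
      rintro rfl
      exact hmem hi) α
    rw [Function.update_of_ne hα, Function.update_self, hV x (fun _ _ => rfl)] at h1
    exact hb h1.symm
  have hloc : ∀ α, ∃ i q, 0 < q ∧ φ^[i + q] α = φ^[i] α := by
    intro α
    refine exists_iterate_eq_of_not_injective fun hinj => ?_
    -- An injective orbit leaves the finite exceptional set, and the identity there forces a
    -- repetition.
    have hfin := hE.preimage (f := fun n => φ^[n] α) hinj.injOn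
    obtain ⟨n, hn⟩ := hfin.infinite_compl.nonempty
    have hn' : φ^[m + p] (φ^[n] α) = φ^[m] (φ^[n] α) := not_not.1 hn
    rw [← Function.iterate_add_apply, ← Function.iterate_add_apply] at hn'
    have := hinj hn'
    omega
  choose I Q hQ hIQ using hloc
  refine ⟨m + ∑ α ∈ hE.toFinset, I α, p * ∏ α ∈ hE.toFinset, Q α,
    Nat.mul_pos hp (Finset.prod_pos fun α _ => hQ α), fun α => ?_⟩
  have key : ∀ {m p : ℕ}, φ^[m + p] α = φ^[m] α → ∀ {M P : ℕ}, m ≤ M → p ∣ P →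
      φ^[M + P] α = φ^[M] α := by
    rintro m p hmp M P hM ⟨r, rfl⟩
    obtain ⟨i, rfl⟩ := Nat.exists_eq_add_of_le' hM
    have hper : Function.IsPeriodicPt φ p (φ^[m] α) := by
      rw [Function.IsPeriodicPt, Function.IsFixedPt, ← Function.iterate_add_apply, add_comm, hmp]
    have := (hper.mul_const r).apply_iterate i
    rw [Function.IsPeriodicPt, Function.IsFixedPt, ← Function.iterate_add_apply,
      ← Function.iterate_add_apply] at this
    rw [Function.iterate_add_apply φ i m, ← this, show i + m + p * r = p * r + i + m by ring]
  by_cases hα : φ^[m + p] α = φ^[m] α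
  · exact key hα (Nat.le_add_right _ _) (dvd_mul_right _ _)
  · have hα' : α ∈ hE.toFinset := by simpa using hα
    exact key (hIQ α)
      ((Finset.single_le_sum (f := I) (fun _ _ => Nat.zero_le _) hα').trans (Nat.le_add_left _ _))
      ((Finset.dvd_prod_of_mem Q hα').trans (dvd_mul_left _ _))

/-- With finite fibres, only countably many points have orbits meeting given orbits; uncountably
many candidates allow disjoint orbits to be chosen one after another. -/
theorem setEntropy_eq_top_of_not_countable {A : Type*} {g : A → A} (hg : FiniteFibre g)
    (h : ¬ {x : A | Function.Injective fun n => g^[n] x}.Countable) : setEntropy g = ⊤ := by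
  let r : A → A → Prop := fun x y => ∀ i j, g^[i] x ≠ g^[j] y
  have : Std.Symm r := ⟨fun x y hxy i j hij => hxy j i hij.symm⟩
  obtain ⟨f, hf, hfr⟩ := exists_seq_of_forall_finset_exists'
    (fun x : A => Function.Injective fun n => g^[n] x) r (by
      intro s _
      have hcount : (⋃ x ∈ s, ⋃ i : ℕ, ⋃ j : ℕ, g^[j] ⁻¹' {g^[i] x}).Countable :=
        s.countable_toSet.biUnion fun x _ => countable_iUnion fun i => countable_iUnion fun j =>
          (hg.preimage_iterate (finite_singleton _) j).countable
      have : ¬ {x : A | Function.Injective fun n => g^[n] x} ⊆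
          ⋃ x ∈ s, ⋃ i : ℕ, ⋃ j : ℕ, g^[j] ⁻¹' {g^[i] x} := fun hsub => h (hcount.mono hsub)
      obtain ⟨y, hy, hys⟩ := not_subset.1 this
      refine ⟨y, hy, fun x hx i j hij => hys ?_⟩
      simp only [mem_iUnion]
      exact ⟨x, hx, i, j, hij.symm⟩)
  refine setEntropy_eq_top (x := fun s i => g^[i] (f s)) ?_ fun _ _ => rfl
  rintro ⟨s, i⟩ ⟨t, j⟩ hst
  have hst' : s = t := by
    by_contra hne
    exact hfr hne i j hst
  subst hst'
  exact Prod.ext rfl (hf s hst)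

theorem setEntropy_shift_eq_top {Γ Y : Type*} [Group Y] [Finite Y] [Nontrivial Y] {φ : Γ → Γ}
    (hφ : FiniteFibre φ) (hσ : FiniteFibre (shift Y φ))
    (h : ¬ ∃ m p, 0 < p ∧ ∀ α, φ^[m + p] α = φ^[m] α) : setEntropy (shift Y φ) = ⊤ := by
  refine setEntropy_eq_top_of_not_countable hσ fun hcount => ?_
  have hcompl : ((quasiPeriodic Y φ : Set (Γ → Y))ᶜ).Countable := by
    refine hcount.mono fun x hx => ?_
    by_contra hinj
    obtain ⟨m, p, hp, hmp⟩ := exists_iterate_eq_of_not_injective hinj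
    refine hx ⟨m, p, hp, fun α => ?_⟩
    simpa only [shift_iterate] using congrFun hmp α
  have hQ : ∃ x₀, x₀ ∉ quasiPeriodic Y φ := by
    by_contra hall
    push Not at hall
    exact h (exists_iterate_eq_of_quasiPeriodic hφ hall)
  obtain ⟨x₀, hx₀⟩ := hQ
  -- Translation by `x₀` injects the subgroup into its complement.
  have hP : (quasiPeriodic Y φ : Set (Γ → Y)).Countable := by
    refine countable_of_injective_of_countable_image (f := fun y => x₀ * y)
      (mul_right_injective x₀).injOn (hcompl.mono ?_)
    rintro _ ⟨y, hy, rfl⟩ hmem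
    exact hx₀ ((Subgroup.mul_mem_cancel_right _ hy).1 hmem)
  have huniv : (univ : Set (Γ → Y)).Countable := by
    rw [← union_compl_self (quasiPeriodic Y φ : Set (Γ → Y))]
    exact hP.union hcompl
  have hΓ : Infinite Γ := by
    by_contra hfin
    rw [not_infinite_iff_finite] at hfin
    obtain ⟨i, j, hne, hij⟩ := Finite.exists_ne_map_eq_of_infinite fun n : ℕ => φ^[n]
    obtain ⟨m, p, hp, hmp⟩ : ∃ m p, 0 < p ∧ φ^[m + p] = φ^[m] := by
      rcases lt_or_gt_of_ne hne with hlt | hlt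
      · exact ⟨i, j - i, by omega, by rw [Nat.add_sub_cancel' hlt.le]; exact hij.symm⟩
      · exact ⟨j, i - j, by omega, by rw [Nat.add_sub_cancel' hlt.le]; exact hij⟩
    exact h ⟨m, p, hp, congrFun hmp⟩
  classical
  obtain ⟨y₀, y₁, hy⟩ := exists_pair_ne Y
  have hinj : Function.Injective fun (s : Set Γ) (γ : Γ) => if γ ∈ s then y₁ else y₀ := by
    intro s t hst
    ext γ
    have := congrFun hst γ
    by_cases h1 : γ ∈ s <;> by_cases h2 : γ ∈ t <;> simp_all [eq_comm]
  have : Countable (Γ → Y) := countable_univ_iff.1 huniv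
  have : Countable (Set Γ) := hinj.countable
  obtain ⟨f, hf⟩ := exists_surjective_nat (Set Γ)
  have he := Function.invFun_surjective (Infinite.natEmbedding Γ).injective
  exact Function.cantor_surjective _ (hf.comp he)

/-- Families marking two points of a backward chain move along it with constant gap, and the gap
separates orbits. This avoids finite fibres of the shift, which fail for `lambda3`. -/
theorem setEntropy_shift_eq_top_of_chain {Γ Y : Type*} [Nontrivial Y] {φ : Γ → Γ} {a : ℕ → Γ}
    (ha : Function.Injective a) (hφ : ∀ i α, φ α = a i ↔ α = a (i + 1)) :
    setEntropy (shift Y φ) = ⊤ := by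
  classical
  obtain ⟨y₀, y₁, hy⟩ := exists_pair_ne Y
  let x : ℕ → ℕ → Γ → Y := fun s i γ => if γ = a i ∨ γ = a (i + 1 + s) then y₁ else y₀
  have hxval : ∀ s i j, x s i (a j) = y₁ ↔ j = i ∨ j = i + 1 + s := by
    intro s i j
    simp only [x, ha.eq_iff]
    split_ifs with h
    · simp [h]
    · simp [h, hy]
  refine setEntropy_eq_top (x := x) ?_ fun s i => ?_
  · rintro ⟨s, i⟩ ⟨t, j⟩ h
    have hiff : ∀ l, (l = i ∨ l = i + 1 + s) ↔ (l = j ∨ l = j + 1 + t) := fun l => by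
      rw [← hxval, ← hxval]
      exact iff_of_eq (congrArg (fun z : Γ → Y => z (a l) = y₁) h)
    have h1 := hiff i
    have h2 := hiff (i + 1 + s)
    have h3 := hiff j
    have h4 := hiff (j + 1 + t)
    rw [Prod.mk.injEq]
    omega
  · induction i with
    | zero => rfl
    | succ i ih =>
      rw [Function.iterate_succ_apply', ih]
      funext γ
      simp only [shift, x, hφ]
      rw [show i + 1 + s + 1 = i + 1 + 1 + s by omega]

/-! ### The comparison of the four entropies -/

theorem ShiftClass.le_set (s : ShiftClass.{u, v}) :
    s.ent .alg ≤ s.ent .set ∧ s.ent .cset ≤ s.ent .set := by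
  by_cases h : ∃ m p, 0 < p ∧ ∀ α, s.ψ^[m + p] α = s.ψ^[m] α
  · obtain ⟨m, p, hp, h⟩ := h
    have h1 : s.ent .alg = 0 := algEntropy_shiftSum_eq_zero s.finiteFibre_map hp h
    have h2 : s.ent .cset = 0 := csetEntropy_shift_eq_zero hp fun α => ⟨m, h α⟩
    rw [h1, h2]
    exact ⟨bot_le, bot_le⟩
  · have h1 : s.ent .set = ⊤ := setEntropy_shift_eq_top s.finiteFibre_map s.finiteFibre_shift h
    rw [h1]
    exact ⟨le_top, le_top⟩

theorem ShiftClass.top_le_cset (s : ShiftClass.{u, v}) : s.ent .top ≤ s.ent .cset :=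
  topEntropy_shift_le_csetEntropy s.ψ

theorem ShiftClass.ent_le_of_tableMark {p q : EntropyKind} (h : tableMark p q = true)
    (s : ShiftClass.{u, v}) : s.ent p ≤ s.ent q := by
  have h1 := s.le_set
  have h2 := s.top_le_cset
  cases p <;> cases q <;> simp only [tableMark, reduceCtorEq] at h
  exacts [le_rfl, h2, h2.trans h1.2, le_rfl, h1.1, le_rfl, h1.2, le_rfl]

/-! ### The shifts of the three maps -/

/-- The two chains `1, 2, 3, …` and `-1, -2, -3, …`. -/
def signedChain (s : Bool) (i : ℕ) : ℤ := if s then (i : ℤ) + 1 else -(i : ℤ) - 1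

theorem signedChain_injective : Function.Injective fun q : Bool × ℕ => signedChain q.1 q.2 := by
  rintro ⟨s, i⟩ ⟨t, j⟩ h
  cases s <;> cases t <;> simp only [signedChain, Prod.mk.injEq] at h ⊢ <;> simp at h ⊢ <;> omega

theorem lambda1_eq_signedChain (s : Bool) (i : ℕ) (α : ℤ) :
    lambda1 α = signedChain s i ↔ α = signedChain s (i + 1) := by
  cases s <;> simp only [signedChain, lambda1] <;> split_ifs <;> simp_all <;> omega

theorem lambda2_signedChain (s : Bool) (i : ℕ) :
    lambda2 (signedChain s i) = signedChain s (i + 1) := by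
  cases s <;> simp only [signedChain, lambda2] <;> split_ifs <;> simp_all <;> omega

theorem exists_abs_le (F : Finset ℤ) : ∃ N : ℕ, ∀ α ∈ F, -(N : ℤ) ≤ α ∧ α ≤ N :=
  ⟨F.sup Int.natAbs, fun α hα => by
    have := Finset.le_sup (f := Int.natAbs) hα
    omega⟩

theorem nonneg_of_triangular {n k : ℤ} (h : 2 * n = k * (k + 1)) : 0 ≤ n := by
  rcases le_or_gt 0 k with hk | hk
  · nlinarith
  · nlinarith

theorem finiteFibre_shift_lambda1 (G : Type*) [Finite G] : FiniteFibre (shift G lambda1) := by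
  refine finiteFibre_shift ?_
  have : range lambda1 = univ := eq_univ_of_forall fun n => by
    rcases le_or_gt 0 n with h | h
    · exact ⟨n + 1, by simp only [lambda1]; split_ifs <;> omega⟩
    · exact ⟨n - 1, by simp only [lambda1]; split_ifs <;> omega⟩
  simp [this]

theorem finiteFibre_shift_lambda2 (G : Type*) [Finite G] : FiniteFibre (shift G lambda2) := by
  refine finiteFibre_shift ((finite_Icc (-1 : ℤ) 1).subset fun n hn => ?_)
  by_contra h
  rw [mem_Icc, not_and_or] at h
  refine hn ?_
  rcases h with h | h
  · exact ⟨n + 1, by simp only [lambda2]; split_ifs <;> omega⟩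
  · exact ⟨n - 1, by simp only [lambda2]; split_ifs <;> omega⟩

theorem lambda1_eventually_fixed (n : ℤ) : ∃ m, lambda1^[m + 1] n = lambda1^[m] n := by
  induction h : n.natAbs generalizing n with
  | zero =>
    obtain rfl : n = 0 := by omega
    exact ⟨0, rfl⟩
  | succ l ih =>
    obtain ⟨m, hm⟩ := ih (lambda1 n) (by simp only [lambda1]; split_ifs <;> omega)
    exact ⟨m + 1, hm⟩

theorem lambda3_eventually_fixed {c : ℤ} (hc : c = 0 ∨ c = 1) (n : ℤ) :
    ∃ m, (lambda3 c)^[m + 1] n = (lambda3 c)^[m] n := by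
  have hfix : ∀ {n k : ℤ}, n ≠ 1 → 2 * n = k * (k + 1) → lambda3 c n = n := fun {n k} h1 h => by
    rw [lambda3, if_neg h1, if_pos ⟨k, h⟩]
  have h0 : lambda3 c 0 = 0 := hfix (k := 0) (by norm_num) (by norm_num)
  have hT : ∃ T : ℤ, n ≤ T ∧ lambda3 c T = T := by
    rcases le_or_gt n 0 with h | h
    · exact ⟨0, h, h0⟩
    -- The triangular number of even index `2 * (n + 1)`, a fixed point beyond `n`.
    · refine ⟨(n + 1) * (2 * (n + 1) + 1), by nlinarith, hfix (k := 2 * (n + 1)) ?_ (by ring)⟩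
      nlinarith
  obtain ⟨T, hnT, hT⟩ := hT
  induction h : (T - n).toNat generalizing n with
  | zero =>
    obtain rfl : n = T := by omega
    exact ⟨0, hT⟩
  | succ l ih =>
    by_cases h1 : n = 1
    · subst h1
      have hlc : lambda3 c 1 = c := by simp [lambda3]
      rcases hc with rfl | rfl
      · exact ⟨1, by simp [hlc, h0]⟩
      · exact ⟨0, hlc⟩
    · by_cases h2 : ∃ k : ℤ, 2 * n = k * (k + 1)
      · obtain ⟨k, hk⟩ := h2
        exact ⟨0, hfix h1 hk⟩
      · have h3 : lambda3 c n = n + 1 := by rw [lambda3, if_neg h1, if_neg h2]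
        obtain ⟨m, hm⟩ := ih (lambda3 c n) (by omega) (by omega)
        exact ⟨m + 1, hm⟩

theorem lambda3_eq_neg_chain {c : ℤ} (hc : c = 0 ∨ c = 1) (i : ℕ) (α : ℤ) :
    lambda3 c α = -(i : ℤ) - 1 ↔ α = -((i + 1 : ℕ) : ℤ) - 1 := by
  simp only [lambda3]
  split_ifs with h1 h2
  · omega
  · obtain ⟨k, hk⟩ := h2
    have := nonneg_of_triangular hk
    omega
  · omega

theorem topEntropy_lambda1 (G : Type*) [TopologicalSpace G] [DiscreteTopology G]
    [Finite G] [Nontrivial G] :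
    topEntropy (shift G lambda1) = 0 :=
  topEntropy_shift_eq_zero fun α => by
    obtain ⟨m, hm⟩ := lambda1_eventually_fixed α
    exact ⟨m, 1, one_pos, hm⟩

theorem csetEntropy_lambda1 (G : Type*) :
    csetEntropy (shift G lambda1) = 0 :=
  csetEntropy_shift_eq_zero one_pos lambda1_eventually_fixed

theorem setEntropy_lambda1 (G : Type*) [Nontrivial G] :
    setEntropy (shift G lambda1) = ⊤ :=
  setEntropy_shift_eq_top_of_chain (a := signedChain true)
    (fun i j h => by
      simpa using @signedChain_injective (true, i) (true, j) h)
    fun i α => lambda1_eq_signedChain true i α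

theorem card_Icc_neg (N : ℕ) : (Finset.Icc (-(N : ℤ)) N).card = 2 * N + 1 := by
  rw [Int.card_Icc]
  omega

theorem algEntropy_lambda1 (G : Type*) [Group G] [Finite G] :
    algEntropy (shiftSum G lambda1 finiteFibre_lambda1) = 2 * logCard G := by
  apply le_antisymm
  · refine (algEntropy_shiftSum_le (k := 2) _ fun F => ?_).trans (by simp)
    obtain ⟨N, hN⟩ := exists_abs_le F
    refine ⟨2 * N + 1, fun n => ⟨Finset.Icc (-((N + n : ℕ) : ℤ)) (N + n : ℕ), ?_, ?_⟩⟩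
    · rw [card_Icc_neg]
      omega
    · intro i hi α hα
      have hit : ∀ i α, α.natAbs ≤ (lambda1^[i] α).natAbs + i := by
        intro i
        induction i with
        | zero => simp
        | succ i ih =>
          intro α
          have h1 := ih (lambda1 α)
          have h2 : α.natAbs ≤ (lambda1 α).natAbs + 1 := by
            simp only [lambda1]; split_ifs <;> omega
          rw [Function.iterate_succ_apply]
          omega
      have h1 := hit i α
      have h2 := hN _ hα
      rw [Finset.mem_Icc]
      omega
  · simpa using le_algEntropy_shiftSum (Y := G) finiteFibre_lambda1 signedChain_injective
      lambda1_eq_signedChain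

theorem topEntropy_lambda2 (G : Type*) [TopologicalSpace G] [DiscreteTopology G]
    [Finite G] [Nontrivial G] :
    topEntropy (shift G lambda2) = 2 * logCard G := by
  apply le_antisymm
  · refine (topEntropy_shift_le (k := 2) fun F => ?_).trans (by simp)
    obtain ⟨N, hN⟩ := exists_abs_le F
    refine ⟨2 * N + 1, fun n => ⟨Finset.Icc (-((N + n : ℕ) : ℤ)) (N + n : ℕ), ?_, ?_⟩⟩
    · rw [card_Icc_neg]
      omega
    · intro i hi α hα
      have hit : ∀ i α, (lambda2^[i] α).natAbs ≤ α.natAbs + i := by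
        intro i
        induction i with
        | zero => simp
        | succ i ih =>
          intro α
          have h1 := ih (lambda2 α)
          have h2 : (lambda2 α).natAbs ≤ α.natAbs + 1 := by
            simp only [lambda2]; split_ifs <;> omega
          rw [Function.iterate_succ_apply]
          omega
      have h1 := hit i α
      have h2 := hN _ hα
      rw [Finset.mem_Icc]
      omega
  · simpa using le_topEntropy_shift (Y := G) signedChain_injective lambda2_signedChain

theorem algEntropy_lambda2 (G : Type*) [Group G] [Finite G] :
    algEntropy (shiftSum G lambda2 finiteFibre_lambda2) = 0 := by
  refine le_antisymm ((algEntropy_shiftSum_le (k := 0) _ fun F => ?_).trans (by simp)) bot_le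
  obtain ⟨N, hN⟩ := exists_abs_le F
  refine ⟨2 * N + 1, fun n => ⟨Finset.Icc (-(N : ℤ)) N, ?_, ?_⟩⟩
  · rw [card_Icc_neg]
    omega
  · intro i hi α hα
    have hit : ∀ i α, α.natAbs ≤ (lambda2^[i] α).natAbs := by
      intro i
      induction i with
      | zero => simp
      | succ i ih =>
        intro α
        have h1 := ih (lambda2 α)
        have h2 : α.natAbs ≤ (lambda2 α).natAbs := by
          simp only [lambda2]; split_ifs <;> omega
        rw [Function.iterate_succ_apply]
        omega
    have h1 := hit i α
    have h2 := hN _ hα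
    rw [Finset.mem_Icc]
    omega

theorem csetEntropy_lambda2 (G : Type*) [Nontrivial G] :
    csetEntropy (shift G lambda2) = ⊤ := by
  refine csetEntropy_shift_eq_top (a := 1) ?_
  have hit : ∀ n, lambda2^[n] 1 = (n : ℤ) + 1 := by
    intro n
    induction n with
    | zero => rfl
    | succ n ih =>
      rw [Function.iterate_succ_apply', ih, lambda2, if_pos (by omega)]
      push_cast
      rfl
  intro i j h
  simpa [hit] using h

/-- The shift of `lambda1` as a member of the class. -/
def shiftClass1 (G : Type w) [Group G] [Finite G] [Nontrivial G] [TopologicalSpace G]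
    [DiscreteTopology G] : ShiftClass.{w, 0} where
  Y := G
  Γ := ℤ
  ψ := lambda1
  finiteFibre_map := finiteFibre_lambda1
  finiteFibre_shift := finiteFibre_shift_lambda1 G

/-- The shift of `lambda2` as a member of the class. -/
def shiftClass2 (G : Type w) [Group G] [Finite G] [Nontrivial G] [TopologicalSpace G]
    [DiscreteTopology G] : ShiftClass.{w, 0} where
  Y := G
  Γ := ℤ
  ψ := lambda2
  finiteFibre_map := finiteFibre_lambda2
  finiteFibre_shift := finiteFibre_shift_lambda2 G

/-- No infinite backward chain of distinct points exists for `lambda2`; the value follows from cset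
≤ set. -/
theorem setEntropy_lambda2 (G : Type*) [Group G] [TopologicalSpace G] [DiscreteTopology G]
    [Finite G] [Nontrivial G] :
    setEntropy (shift G lambda2) = ⊤ :=
  top_le_iff.1 ((csetEntropy_lambda2 G).symm.le.trans (shiftClass2 G).le_set.2)

theorem topEntropy_lambda3 (G : Type*) [TopologicalSpace G] [DiscreteTopology G]
    [Finite G] [Nontrivial G] {c : ℤ} (hc : c = 0 ∨ c = 1) :
    topEntropy (shift G (lambda3 c)) = 0 :=
  topEntropy_shift_eq_zero fun α => by
    obtain ⟨m, hm⟩ := lambda3_eventually_fixed hc α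
    exact ⟨m, 1, one_pos, hm⟩

theorem csetEntropy_lambda3 (G : Type*) {c : ℤ} (hc : c = 0 ∨ c = 1) :
    csetEntropy (shift G (lambda3 c)) = 0 :=
  csetEntropy_shift_eq_zero one_pos (lambda3_eventually_fixed hc)

theorem setEntropy_lambda3 (G : Type*) [Nontrivial G] {c : ℤ} (hc : c = 0 ∨ c = 1) :
    setEntropy (shift G (lambda3 c)) = ⊤ :=
  setEntropy_shift_eq_top_of_chain (a := fun i : ℕ => -(i : ℤ) - 1)
    (fun i j h => by simpa using h) (lambda3_eq_neg_chain hc)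

theorem algEntropy_lambda3 (G : Type*) [Group G] [Finite G] {c : ℤ} (hc : c = 0 ∨ c = 1) :
    algEntropy (shiftSum G (lambda3 c) (finiteFibre_lambda3 c)) = logCard G := by
  apply le_antisymm
  · refine (algEntropy_shiftSum_le (k := 1) _ fun F => ?_).trans (by simp)
    obtain ⟨N, hN⟩ := exists_abs_le F
    refine ⟨2 * N + 2, fun n => ⟨Finset.Icc (-((N + n : ℕ) : ℤ)) (N + 1 : ℕ), ?_, ?_⟩⟩
    · rw [Int.card_Icc]
      omega
    · intro i hi α hα
      -- Only the point `1` can move down, so preimages of a bounded set spread only to the left,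
      -- one unit per step.
      have hit : ∀ i α, α ≤ max ((lambda3 c)^[i] α) 1 ∧ (lambda3 c)^[i] α ≤ α + i := by
        intro i
        induction i with
        | zero => simp
        | succ i ih =>
          intro α
          have h1 := ih (lambda3 c α)
          have h2 : α ≤ max (lambda3 c α) 1 ∧ lambda3 c α ≤ α + 1 := by
            simp only [lambda3]; split_ifs <;> omega
          rw [Function.iterate_succ_apply]
          push_cast
          omega
      have h1 := hit i α
      have h2 := hN _ hα
      rw [Finset.mem_Icc]
      omega
  · have := le_algEntropy_shiftSum (Y := G) (finiteFibre_lambda3 c)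
      (a := fun (_ : Unit) (i : ℕ) => -(i : ℤ) - 1)
      (by rintro ⟨_, i⟩ ⟨_, j⟩ h; simpa using h) fun _ => lambda3_eq_neg_chain hc
    simpa using this

theorem logCard_pos (G : Type*) [Finite G] [Nontrivial G] : 0 < logCard G :=
  ENNReal.ofReal_pos.2 (Real.log_pos (by exact_mod_cast Finite.one_lt_card))

theorem exists_ent_lt_of_tableMark {p q : EntropyKind} (h : tableMark p q = false) :
    ∃ s : ShiftClass.{0, 0}, s.ent q < s.ent p := by
  let G := Multiplicative (ZMod 2)
  let _ : TopologicalSpace G := ⊥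
  have : DiscreteTopology G := ⟨rfl⟩
  have hpos : 0 < 2 * logCard G := ENNReal.mul_pos (by simp) (logCard_pos G).ne'
  have hlt : 2 * logCard G < ⊤ := ENNReal.mul_lt_top (by simp) ENNReal.ofReal_lt_top
  have t1 : (shiftClass1 G).ent .top = 0 := topEntropy_lambda1 G
  have a1 : (shiftClass1 G).ent .alg = 2 * logCard G := algEntropy_lambda1 G
  have c1 : (shiftClass1 G).ent .cset = 0 := csetEntropy_lambda1 G
  have s1 : (shiftClass1 G).ent .set = ⊤ := setEntropy_lambda1 G
  have t2 : (shiftClass2 G).ent .top = 2 * logCard G := topEntropy_lambda2 G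
  have a2 : (shiftClass2 G).ent .alg = 0 := algEntropy_lambda2 G
  have c2 : (shiftClass2 G).ent .cset = ⊤ := csetEntropy_lambda2 G
  cases p <;> cases q <;> simp only [tableMark, reduceCtorEq] at h
  · exact ⟨shiftClass2 G, by rw [t2, a2]; exact hpos⟩
  · exact ⟨shiftClass1 G, by rw [t1, a1]; exact hpos⟩
  · exact ⟨shiftClass1 G, by rw [c1, a1]; exact hpos⟩
  · exact ⟨shiftClass2 G, by rw [t2, c2]; exact hlt⟩
  · exact ⟨shiftClass2 G, by rw [a2, c2]; exact ENNReal.zero_lt_top⟩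
  · exact ⟨shiftClass1 G, by rw [t1, s1]; exact ENNReal.zero_lt_top⟩
  · exact ⟨shiftClass1 G, by rw [a1, s1]; exact hlt⟩
  · exact ⟨shiftClass1 G, by rw [c1, s1]; exact ENNReal.zero_lt_top⟩

end GenShift

theorem mainTheorem8 :
    (∀ p q : GenShift.EntropyKind, GenShift.tableMark p q = true →
      ∀ s : GenShift.ShiftClass.{u, v}, s.ent p ≤ s.ent q) ∧
    (∀ p q : GenShift.EntropyKind, GenShift.tableMark p q = false →
      ∃ s : GenShift.ShiftClass.{0, 0}, s.ent q < s.ent p) ∧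
    (∀ (G : Type w) [CommGroup G] [Finite G] [Nontrivial G] [TopologicalSpace G]
        [DiscreteTopology G],
      -- the shifts of `λ₁` and `λ₂` belong to the class
      (GenShift.FiniteFibre (GenShift.shift G GenShift.lambda1) ∧
        GenShift.FiniteFibre (GenShift.shift G GenShift.lambda2)) ∧
      -- `λ₁`
      (GenShift.topEntropy (GenShift.shift G GenShift.lambda1) = 0 ∧
        GenShift.algEntropy
          (GenShift.shiftSum G GenShift.lambda1 GenShift.finiteFibre_lambda1) =
            2 * GenShift.logCard G ∧
        GenShift.csetEntropy (GenShift.shift G GenShift.lambda1) = 0 ∧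
        GenShift.setEntropy (GenShift.shift G GenShift.lambda1) = ⊤) ∧
      -- `λ₂`
      (GenShift.topEntropy (GenShift.shift G GenShift.lambda2) = 2 * GenShift.logCard G ∧
        GenShift.algEntropy
          (GenShift.shiftSum G GenShift.lambda2 GenShift.finiteFibre_lambda2) = 0 ∧
        GenShift.csetEntropy (GenShift.shift G GenShift.lambda2) = ⊤ ∧
        GenShift.setEntropy (GenShift.shift G GenShift.lambda2) = ⊤) ∧
      -- `λ₃`, for either value `0` or `1` at the point `1`
      (∀ c : ℤ, c = 0 ∨ c = 1 →
        GenShift.topEntropy (GenShift.shift G (GenShift.lambda3 c)) = 0 ∧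
        GenShift.algEntropy
          (GenShift.shiftSum G (GenShift.lambda3 c) (GenShift.finiteFibre_lambda3 c)) =
            GenShift.logCard G ∧
        GenShift.csetEntropy (GenShift.shift G (GenShift.lambda3 c)) = 0 ∧
        GenShift.setEntropy (GenShift.shift G (GenShift.lambda3 c)) = ⊤)) := by
  refine ⟨fun p q h s => s.ent_le_of_tableMark h,
    fun p q h => GenShift.exists_ent_lt_of_tableMark h, ?_⟩
  intro G _ _ _ _ _
  exact ⟨⟨GenShift.finiteFibre_shift_lambda1 G, GenShift.finiteFibre_shift_lambda2 G⟩,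
    ⟨GenShift.topEntropy_lambda1 G, GenShift.algEntropy_lambda1 G, GenShift.csetEntropy_lambda1 G,
      GenShift.setEntropy_lambda1 G⟩,
    ⟨GenShift.topEntropy_lambda2 G, GenShift.algEntropy_lambda2 G, GenShift.csetEntropy_lambda2 G,
      GenShift.setEntropy_lambda2 G⟩,
    fun c hc => ⟨GenShift.topEntropy_lambda3 G hc, GenShift.algEntropy_lambda3 G hc,
      GenShift.csetEntropy_lambda3 G hc, GenShift.setEntropy_lambda3 G hc⟩⟩
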